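/- **Theorem (Termination).** Let $\mathcal D$ be a constraint domain over a first-order signature and a structure with non-empty universe: a class of formulas (constraints) containing $true$ and all equations between terms, closed under conjunction and renaming of variables, with a projection $Proj(S,c)$ onto finite sets $S$ of variables (a constraint over $S$ whose solutions are exactly the valuations that agree on $S$ with a solution of $c$). Write $c\sqsubseteq c'$ ($c$ *entails* $c'$) if every solution of $c$ is a solution of $c'$. A set $A$ of constraints is *constraint-compact* if for every finite set $S$ of variables and every $C\subseteq A$ whose members have all their variables in $S$ there is a finite $C_{fin}\subseteq C$ such that every $c\in C$ entails some $c'\in C_{fin}$. Let $P$ be a definite constraint logic program over $\mathcal D$: finitely many clauses $h\,\text{:-}\,c_h,l_1,\dots,l_k$ with $h$ an atom whose arguments are distinct variables, $c_h$ a constraint and $l_i$ atoms (called literals), together with a set of tabled predicates, such that every cycle of the predicate dependency graph of $P$ contains a tabled predicate (for instance, all predicates are tabled). Let $\langle Q,c_q\rangle$ be a query: a finite multiset $Q$ of literals and a constraint $c_q$. A *TCLP execution* of $\langle Q,c_q\rangle$ builds a forest of search trees whose nodes are states $\langle R,c\rangle$ ($R$ a multiset of literals and constraints, $c$ a constraint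 store), starting from the root $\langle Q,c_q\rangle$. It performs the following steps, in any order and with any choice of the selected element of a resolvent, as long as one is possible. - A selected constraint is added to the store; the branch fails if the store becomes inconsistent. - A selected literal $t$ whose predicate is not tabled is resolved against the clauses of $P$ for its predicate, renamed apart; each of them replaces $t$ by $t=h$, $c_h$, $l_1,\dots,l_k$. - If a selected literal $t$ is tabled and $c$ is the store, the goal $\langle t,c\rangle$ becomes a consumer of the oldest generator $\langle g,c_g\rangle$ (taken renamed apart from $\langle t,c\rangle$) such that $t$ and $g$ are equal up to renaming of variables and $c\wedge(t=g)\sqsubseteq c_g$, where $t=g$ equates the corresponding variables of $t$ and $g$. If there is no such generator, a new generator $\langle t,Proj(vars(t),c)\rangle$ is created, of which $\langle t,c\rangle$ is a consumer; the generator becomes the root of a new search tree and is resolved against the clauses of $P$ for its predicate. - A consumer consumes an answer currently kept for its generator that it has not consumed before: the answer, renamed to the variables of the call, is added to the store; the branch fails if the store becomes inconsistent. - When a state $\langle\emptyset,c\rangle$ is reached in the tree of a generator $\langle g,c_g\rangle$, the answer $Proj(vars(g),c)$ is discarded if it entails an answer already kept for that generator; otherwise it is kept, and the kept answers that entail it are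 removed. The execution *terminates* if it reaches a situation in which no step is possible. Then every TCLP execution of $\langle Q,c_q\rangle$ terminates if and only if both of the following conditions hold for its forest $\mathcal F(Q,c_q)$. 1. For every literal $g$, the set $C_g$ is constraint-compact, where $C_g$ is the set of all constraint stores, projected and renamed with respect to the arguments of $g$, with which a variant of $g$ is called in $\mathcal F(Q,c_q)$. 2. For every goal $\langle g,c_g\rangle$, the set $A_{\langle g,c_g\rangle}$ is constraint-compact, where $A_{\langle g,c_g\rangle}$ is the set of all answer constraints (kept or not), projected and renamed with respect to the arguments of $g$, of the successful derivations in the trees of $\mathcal F(Q,c_q)$ whose root is a variant of $\langle g,c_g\rangle$. -/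

import Mathlib

noncomputable section

namespace TCLP

universe u v w x

variable {L : FirstOrder.Language.{u, v}} {M : Type w} [L.Structure M]

/-- A constraint domain over the signature `L` and the structure `M`: a class of first-order
`L`-formulas over the variables `ℕ` (the constraints), containing the empty conjunction and all
equations between terms, closed under conjunction and renaming of variables, together with a
projection operation. -/
structure ConstraintDomain (L : FirstOrder.Language.{u, v}) (M : Type w) [L.Structure M] where
  /-- the formulas that are constraints -/
  con : Set (L.Formula ℕ)
  top_mem : (⊤ : L.Formula ℕ) ∈ con
  equal_mem : ∀ s t : L.Term ℕ, s.equal t ∈ con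
  inf_mem : ∀ {φ ψ : L.Formula ℕ}, φ ∈ con → ψ ∈ con → φ ⊓ ψ ∈ con
  relabel_mem : ∀ (ρ : Equiv.Perm ℕ) {φ : L.Formula ℕ}, φ ∈ con → φ.relabel ρ ∈ con
  /-- `proj S φ` is the projection of `φ` onto the finite set `S` of variables -/
  proj : Finset ℕ → con → con
  proj_vars : ∀ S φ, (proj S φ).1.freeVarFinset ⊆ S
  proj_of_solution : ∀ S φ (val : ℕ → M), φ.1.Realize val → (proj S φ).1.Realize val
  solution_of_proj : ∀ S φ (val : ℕ → M), (proj S φ).1.Realize val →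
    ∃ val' : ℕ → M, (∀ y ∈ S, val' y = val y) ∧ φ.1.Realize val'

namespace ConstraintDomain

variable (D : ConstraintDomain L M)

/-- The constraints expressible in the domain. -/
abbrev Constraint : Type (max u v) := {φ : L.Formula ℕ // φ ∈ D.con}

end ConstraintDomain

namespace Constraint

variable {D : ConstraintDomain L M}

/-- The variables of a constraint. -/
def vars (c : D.Constraint) : Finset ℕ := c.1.freeVarFinset

/-- The valuation `val` is a solution of `c`. -/
def Sat (c : D.Constraint) (val : ℕ → M) : Prop := c.1.Realize val

/-- `c` has a solution. -/
def Consistent (c : D.Constraint) : Prop := ∃ val : ℕ → M, Sat c val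

/-- Entailment `c ⊑ c'`: every solution of `c` is a solution of `c'`. -/
def Entails (c c' : D.Constraint) : Prop := ∀ val : ℕ → M, Sat c val → Sat c' val

def and (c c' : D.Constraint) : D.Constraint := ⟨c.1 ⊓ c'.1, D.inf_mem c.2 c'.2⟩

def true : D.Constraint := ⟨⊤, D.top_mem⟩

/-- The equation `s = t`. -/
def eqn (s t : L.Term ℕ) : D.Constraint := ⟨s.equal t, D.equal_mem s t⟩

/-- Conjunction of a list of constraints. -/
def conj (cs : List D.Constraint) : D.Constraint := cs.foldr and true

def rename (ρ : Equiv.Perm ℕ) (c : D.Constraint) : D.Constraint :=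
  ⟨c.1.relabel ρ, D.relabel_mem ρ c.2⟩

/-- A set `A` of constraints is constraint-compact: for every finite set `S` of variables, every
`C ⊆ A` whose members only have variables in `S` is covered, in the sense of entailment, by a
finite subset of `C`. -/
def Compact (A : Set D.Constraint) : Prop :=
  ∀ S : Finset ℕ, ∀ C ⊆ A, (∀ c ∈ C, vars c ⊆ S) →
    ∃ F ⊆ C, F.Finite ∧ ∀ c ∈ C, ∃ c' ∈ F, Entails c c'

end Constraint

/-- A (positive) literal `p(t₁, …, tₙ)`; `ar p` is the arity of the predicate symbol `p`. -/
structure Literal (L : FirstOrder.Language.{u, v}) {Pred : Type x} (ar : Pred → ℕ) where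
  pred : Pred
  args : Fin (ar pred) → L.Term ℕ

namespace Literal

variable {Pred : Type x} {ar : Pred → ℕ}

def vars (t : Literal L ar) : Finset ℕ := Finset.univ.biUnion fun i => (t.args i).varFinset

def rename (ρ : Equiv.Perm ℕ) (t : Literal L ar) : Literal L ar :=
  ⟨t.pred, fun i => (t.args i).relabel ρ⟩

end Literal

/-- A definite clause `p(X₁, …, Xₙ) :- c, l₁, …, lₖ` with linearized head (the `Xᵢ` are distinct
variables). -/
structure Clause (D : ConstraintDomain L M) {Pred : Type x} (ar : Pred → ℕ) where
  pred : Pred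
  headVars : Fin (ar pred) → ℕ
  linear : Function.Injective headVars
  con : D.Constraint
  body : List (Literal L ar)

namespace Clause

variable {D : ConstraintDomain L M} {Pred : Type x} {ar : Pred → ℕ}

def rename (ρ : Equiv.Perm ℕ) (cl : Clause D ar) : Clause D ar where
  pred := cl.pred
  headVars := fun i => ρ (cl.headVars i)
  linear := ρ.injective.comp cl.linear
  con := Constraint.rename ρ cl.con
  body := cl.body.map (Literal.rename ρ)

def vars (cl : Clause D ar) : Finset ℕ :=
  Finset.univ.image cl.headVars ∪ Constraint.vars cl.con ∪ (cl.body.map Literal.vars).foldr (· ∪ ·) ∅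

/-- The constraint `t = h`, with `h` the head of the clause: the conjunction of the equations
between corresponding arguments. -/
def headEqn (cl : Clause D ar) (t : Literal L ar) (h : t.pred = cl.pred) : D.Constraint :=
  Constraint.conj <| (List.finRange (ar t.pred)).map fun i =>
    Constraint.eqn (t.args i) (FirstOrder.Language.Term.var (cl.headVars (Fin.cast (congrArg ar h) i)))

end Clause

/-- A program: finitely many clauses, and the set of its tabled predicates. -/
structure Program (D : ConstraintDomain L M) {Pred : Type x} (ar : Pred → ℕ) where
  clauses : List (Clause D ar)
  tab : Set Pred

section Execution

variable {D : ConstraintDomain L M} {Pred : Type x} {ar : Pred → ℕ}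

/-- `p` depends directly on `q` and neither is tabled: some clause for `p` has a body literal with
predicate `q`. -/
def Program.UntabledCall (P : Program D ar) (p q : Pred) : Prop :=
  p ∉ P.tab ∧ q ∉ P.tab ∧ ∃ cl ∈ P.clauses, cl.pred = p ∧ ∃ l ∈ cl.body, l.pred = q

/-- Every cycle of the predicate dependency graph of the program contains a tabled predicate. -/
def Program.RecursionTabled (P : Program D ar) : Prop :=
  ∀ p, ¬ Relation.TransGen P.UntabledCall p p

/-- The clauses of the program for the predicate of `t`. -/
def Program.clausesFor (P : Program D ar) (t : Literal L ar) : Multiset (Clause D ar) :=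
  open Classical in ((P.clauses.filter fun cl => t.pred = cl.pred : List (Clause D ar)) : Multiset _)

/-- The elements of a resolvent: literals and constraints. -/
inductive Item (D : ConstraintDomain L M) {Pred : Type x} (ar : Pred → ℕ) where
  | lit (t : Literal L ar)
  | con (c : D.Constraint)

def Item.vars : Item D ar → Finset ℕ
  | .lit t => t.vars
  | .con c => Constraint.vars c

/-- The variables of a resolvent. -/
def resolventVars (R : Multiset (Item D ar)) : Finset ℕ := (R.map Item.vars).sup

/-- A state `⟨R, c⟩`. -/
structure State (D : ConstraintDomain L M) {Pred : Type x} (ar : Pred → ℕ) where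
  resolvent : Multiset (Item D ar)
  store : D.Constraint

def State.vars (s : State D ar) : Finset ℕ := resolventVars s.resolvent ∪ Constraint.vars s.store

/-- The progress of the evaluation at a node of a search tree.
* `fresh`: no element of the resolvent has been selected yet;
* `resolving t R pending`: `t` has been selected, `R` is the rest of the resolvent, and `t` is
  resolved against program clauses, of which those in `pending` are still to be tried;
* `consuming t R k used`: `t` has been selected, `R` is the rest of the resolvent, and `t` is
  resolved by answer resolution with the answers of the `k`-th generator, of which those in
  `used` have been consumed;
* `done`: the node has been processed (constraint handling or end of a derivation). -/
inductive Work (D : ConstraintDomain L M) {Pred : Type x} (ar : Pred → ℕ) where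
  | fresh
  | resolving (t : Literal L ar) (R : Multiset (Item D ar)) (pending : Multiset (Clause D ar))
  | consuming (t : Literal L ar) (R : Multiset (Item D ar)) (k : ℕ) (used : Set D.Constraint)
  | done

/-- A node of a search tree in the forest. `gen` is the number of the generator to which its tree
belongs (`none` for the tree of the query), `root` is the root state of that tree. -/
structure Node (D : ConstraintDomain L M) {Pred : Type x} (ar : Pred → ℕ) where
  gen : Option ℕ
  root : State D ar
  state : State D ar
  work : Work D ar

/-- A generator `⟨g, c_g⟩` with the answers currently kept for it. -/
structure Generator (D : ConstraintDomain L M) {Pred : Type x} (ar : Pred → ℕ) where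
  lit : Literal L ar
  store : D.Constraint
  answers : List D.Constraint

/-- A configuration of the evaluation: the nodes of the forest built so far, and the generators in
order of creation (oldest first). -/
structure Config (D : ConstraintDomain L M) {Pred : Type x} (ar : Pred → ℕ) where
  nodes : List (Node D ar)
  gens : List (Generator D ar)

/-- The goal `⟨t, c⟩` entails the generator `⟨g, c_g⟩`: after renaming `⟨g, c_g⟩` apart from
`⟨t, c⟩` to `⟨g', c'⟩`, the literals `t` and `g'` are equal upon a variable renaming `ρ` and
`c ∧ (t = g') ⊑ c'`, where `t = g'` equates the corresponding variables of `t` and `g'`. -/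
def CallEntails (t : Literal L ar) (c : D.Constraint) (g : Literal L ar) (cg : D.Constraint) :
    Prop :=
  ∃ σ ρ : Equiv.Perm ℕ, t.rename ρ = g.rename σ ∧
    Disjoint (g.rename σ).vars (t.vars ∪ Constraint.vars c) ∧
    Constraint.Entails
      (Constraint.and c <| Constraint.conj <| t.vars.toList.map fun y =>
        Constraint.eqn (FirstOrder.Language.Term.var y) (FirstOrder.Language.Term.var (ρ y)))
      (Constraint.rename σ cg)

/-- The answer entailment phase: an answer that entails one already kept is discarded; otherwise it
is kept, and those that entail it are removed. -/
def addAnswer (as : List D.Constraint) (a : D.Constraint) : List D.Constraint :=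
  open Classical in
  if ∃ b ∈ as, Constraint.Entails a b then as
  else (as.filter fun b => ¬ Constraint.Entails b a) ++ [a]

/-- Replace the `i`-th node by `N` and add the nodes `new`. -/
def Config.update (K : Config D ar) (i : ℕ) (N : Node D ar) (new : List (Node D ar)) :
    Config D ar :=
  ⟨K.nodes.set i N ++ new, K.gens⟩

/-- The child of the node `N` with the state `⟨R, c⟩`. -/
def Node.child (N : Node D ar) (R : Multiset (Item D ar)) (c : D.Constraint) : Node D ar :=
  ⟨N.gen, N.root, ⟨R, c⟩, .fresh⟩

def Node.withWork (N : Node D ar) (W : Work D ar) : Node D ar := ⟨N.gen, N.root, N.state, W⟩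

/-- The child of `N` with the state `⟨R, c⟩` if `c` is consistent, and no child otherwise. -/
def Node.childIfConsistent (N : Node D ar) (R : Multiset (Item D ar)) (c : D.Constraint) :
    List (Node D ar) :=
  open Classical in if Constraint.Consistent c then [N.child R c] else []

/-- The steps of the evaluation. The computation rule (which element of a resolvent is selected),
the search strategy and the scheduling of consumers are left open: any choice is a step. -/
inductive Step (P : Program D ar) : Config D ar → Config D ar → Prop
  /-- Constraint handling: a selected constraint is added to the store. -/
  | constraint {K : Config D ar} {i : ℕ} {N : Node D ar} {c : D.Constraint}
      {R : Multiset (Item D ar)}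
      (hN : K.nodes[i]? = some N) (hw : N.work = .fresh)
      (hR : N.state.resolvent = .con c ::ₘ R) :
      Step P K (K.update i (N.withWork .done)
        (N.childIfConsistent R (Constraint.and N.state.store c)))
  /-- A literal whose predicate is not tabled is selected; it will be resolved against clauses. -/
  | untabled {K : Config D ar} {i : ℕ} {N : Node D ar} {t : Literal L ar}
      {R : Multiset (Item D ar)}
      (hN : K.nodes[i]? = some N) (hw : N.work = .fresh)
      (hR : N.state.resolvent = .lit t ::ₘ R) (ht : t.pred ∉ P.tab) :
      Step P K (K.update i (N.withWork (.resolving t R (P.clausesFor t))) [])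
  /-- Call entailment phase, the call entails a previous generator: it becomes a consumer of the
  oldest such generator. -/
  | consumer {K : Config D ar} {i : ℕ} {N : Node D ar} {t : Literal L ar}
      {R : Multiset (Item D ar)} {k : ℕ} {G : Generator D ar}
      (hN : K.nodes[i]? = some N) (hw : N.work = .fresh)
      (hR : N.state.resolvent = .lit t ::ₘ R) (ht : t.pred ∈ P.tab)
      (hG : K.gens[k]? = some G) (hent : CallEntails t N.state.store G.lit G.store)
      (hold : ∀ j < k, ∀ G', K.gens[j]? = some G' →
        ¬ CallEntails t N.state.store G'.lit G'.store) :
      Step P K (K.update i (N.withWork (.consuming t R k ∅)) [])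
  /-- Call entailment phase, the call entails no previous generator: a new generator is created
  from the projected store, together with the root of its tree, and the call consumes its
  answers. -/
  | generator {K : Config D ar} {i : ℕ} {N : Node D ar} {t : Literal L ar}
      {R : Multiset (Item D ar)}
      (hN : K.nodes[i]? = some N) (hw : N.work = .fresh)
      (hR : N.state.resolvent = .lit t ::ₘ R) (ht : t.pred ∈ P.tab)
      (hnew : ∀ G ∈ K.gens, ¬ CallEntails t N.state.store G.lit G.store) :
      Step P K
        ⟨K.nodes.set i (N.withWork (.consuming t R K.gens.length ∅)) ++
          [⟨some K.gens.length, ⟨{.lit t}, D.proj t.vars N.state.store⟩,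
            ⟨{.lit t}, D.proj t.vars N.state.store⟩, .resolving t 0 (P.clausesFor t)⟩],
         K.gens ++ [⟨t, D.proj t.vars N.state.store, []⟩]⟩
  /-- Resolution against a program clause, renamed apart. -/
  | resolve {K : Config D ar} {i : ℕ} {N : Node D ar} {t : Literal L ar}
      {R : Multiset (Item D ar)} {pending : Multiset (Clause D ar)} {cl : Clause D ar}
      (ρ : Equiv.Perm ℕ)
      (hN : K.nodes[i]? = some N) (hw : N.work = .resolving t R (cl ::ₘ pending))
      (hcl : t.pred = (cl.rename ρ).pred)
      (hfresh : Disjoint (cl.rename ρ).vars (N.state.vars ∪ N.root.vars)) :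
      Step P K (K.update i (N.withWork (.resolving t R pending))
        [N.child
          (.con ((cl.rename ρ).headEqn t hcl) ::ₘ .con (cl.rename ρ).con ::ₘ
            (((cl.rename ρ).body.map Item.lit : List (Item D ar)) : Multiset (Item D ar)) + R)
          N.state.store])
  /-- Answer resolution: a consumer consumes an answer of its generator, renamed to the variables
  of the call. -/
  | consume {K : Config D ar} {i : ℕ} {N : Node D ar} {t : Literal L ar}
      {R : Multiset (Item D ar)} {k : ℕ} {used : Set D.Constraint} {G : Generator D ar}
      {a : D.Constraint} (ρ : Equiv.Perm ℕ)
      (hN : K.nodes[i]? = some N) (hw : N.work = .consuming t R k used)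
      (hG : K.gens[k]? = some G) (ha : a ∈ G.answers) (hused : a ∉ used)
      (hρ : G.lit.rename ρ = t) :
      Step P K (K.update i (N.withWork (.consuming t R k (insert a used)))
        (N.childIfConsistent R (Constraint.and N.state.store (Constraint.rename ρ a))))
  /-- Answer entailment phase: the end of a successful derivation in the tree of a generator. -/
  | answer {K : Config D ar} {i : ℕ} {N : Node D ar} {k : ℕ} {G : Generator D ar}
      (hN : K.nodes[i]? = some N) (hw : N.work = .fresh) (hR : N.state.resolvent = 0)
      (hk : N.gen = some k) (hG : K.gens[k]? = some G) :
      Step P K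
        ⟨K.nodes.set i (N.withWork .done),
         K.gens.set k
          ⟨G.lit, G.store, addAnswer G.answers (D.proj G.lit.vars N.state.store)⟩⟩
  /-- The end of a successful derivation in the tree of the query. -/
  | queryAnswer {K : Config D ar} {i : ℕ} {N : Node D ar}
      (hN : K.nodes[i]? = some N) (hw : N.work = .fresh) (hR : N.state.resolvent = 0)
      (hk : N.gen = none) :
      Step P K (K.update i (N.withWork .done) [])

/-- The initial state `⟨Q, c_q⟩` of the evaluation of a query. -/
def queryState (Q : Multiset (Literal L ar)) (cq : D.Constraint) : State D ar :=
  ⟨Q.map Item.lit, cq⟩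

/-- The initial configuration: only the root of the tree of the query. -/
def initial (Q : Multiset (Literal L ar)) (cq : D.Constraint) : Config D ar :=
  ⟨[⟨none, queryState Q cq, queryState Q cq, .fresh⟩], []⟩

/-- No step is possible. -/
def Final (P : Program D ar) (K : Config D ar) : Prop := ∀ K', ¬ Step P K K'

/-- `E` is a TCLP execution of the query `⟨Q, c_q⟩`: it starts in the initial configuration and
makes steps as long as this is possible (after a final configuration it stays there). -/
structure IsExecution (P : Program D ar) (Q : Multiset (Literal L ar)) (cq : D.Constraint)
    (E : ℕ → Config D ar) : Prop where
  start : E 0 = initial Q cq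
  next : ∀ n, Step P (E n) (E (n + 1)) ∨ Final P (E n) ∧ E (n + 1) = E n

/-- The execution terminates: it reaches a final configuration. -/
def Terminates (P : Program D ar) (E : ℕ → Config D ar) : Prop := ∃ n, Final P (E n)

/-- The nodes of the forest built by an execution. -/
def forest (E : ℕ → Config D ar) : Set (Node D ar) := {N | ∃ n, N ∈ (E n).nodes}

/-- The literal `t` is called at the node `N`. -/
def Node.Calls (N : Node D ar) (t : Literal L ar) : Prop :=
  (∃ R pending, N.work = .resolving t R pending) ∨ ∃ R k used, N.work = .consuming t R k used

/-- The set `C_g` of the constraint stores, projected and renamed with respect to the arguments of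
`g`, with which (a variant of) `g` is called in the forest. -/
def callStores (E : ℕ → Config D ar) (g : Literal L ar) : Set D.Constraint :=
  {c | ∃ N ∈ forest E, ∃ t, N.Calls t ∧ ∃ ρ : Equiv.Perm ℕ, t.rename ρ = g ∧
    c = Constraint.rename ρ (D.proj t.vars N.state.store)}

/-- The set `A_⟨g, c_g⟩` of the answer constraints, projected and renamed with respect to the
arguments of `g`, of the successful derivations in the trees of the forest whose root is (a variant
of) the goal `⟨g, c_g⟩`. -/
def answerStores (E : ℕ → Config D ar) (g : Literal L ar) (cg : D.Constraint) :
    Set D.Constraint :=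
  {a | ∃ N ∈ forest E, ∃ t c, N.root = ⟨{.lit t}, c⟩ ∧ N.state.resolvent = 0 ∧
    ∃ ρ : Equiv.Perm ℕ, t.rename ρ = g ∧ Constraint.rename ρ c = cg ∧
      a = Constraint.rename ρ (D.proj t.vars N.state.store)}

end Execution

end TCLP

end

/-! If an execution terminates, its forest is finite. Each node calls at most one literal and
belongs to one tree, so it contributes a single call store and a single answer up to equivalence. A
set that is finite up to equivalence is constraint-compact (`compact_of_finite_index`).

Conversely, suppose that an execution never stops. Compactness forbids an infinite sequence over
finitely many variables in which no member entails an earlier one (`exists_entails_of_infinite`).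
Every called literal is a variant of one of the finitely many literals of program and query.
Infinitely many generators would thus include infinitely many for variants of one literal; some
later one would entail an earlier one and should have become its consumer
(`finite_setOf_length_gens_ne`). Likewise, the kept answers of a generator change only when an
answer arrives that entails no kept one. What was once covered stays covered, so this happens
finitely often (`finite_setOf_getElem?_gens_ne`).

From some moment on, then, the generators are constant. Every step now replaces one node by finitely
many nodes of smaller rank, in a well-founded multiset order (`Step.cutExpand_nodeRank`), which
cannot go on forever. Only here is it used that recursion passes through tabled predicates. -/

namespace TCLP

universe u v w x

/-! ### Variables of terms and formulas under relabelling. -/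

section Formulas

variable {L : FirstOrder.Language.{u, v}}

theorem varFinsetLeft_relabel {α β γ δ : Type*} [DecidableEq α] [DecidableEq β]
    (g : α ⊕ γ → β ⊕ δ) (t : L.Term (α ⊕ γ)) (S : Finset β)
    (h : ∀ a b, g a = Sum.inl b → (∃ a' ∈ t.varFinsetLeft, a = Sum.inl a') ∨ a.isRight → b ∈ S) :
    (t.relabel g).varFinsetLeft ⊆ S := by
  induction t with
  | var a =>
    rcases hg : g a with b | d
    · have := h a b hg
      rcases a with a | a <;> simp_all [FirstOrder.Language.Term.relabel, FirstOrder.Language.Term.varFinsetLeft]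
    · simp [FirstOrder.Language.Term.relabel, FirstOrder.Language.Term.varFinsetLeft, hg]
  | func f ts ih =>
    simp only [FirstOrder.Language.Term.relabel, FirstOrder.Language.Term.varFinsetLeft, Finset.biUnion_subset]
    intro i _
    refine ih i fun a b hab hor => h a b hab ?_
    rcases hor with ⟨a', ha', rfl⟩ | hr
    · exact Or.inl ⟨a', by simpa [FirstOrder.Language.Term.varFinsetLeft] using ⟨i, ha'⟩, rfl⟩
    · exact Or.inr hr

theorem freeVarFinset_relabel {α β : Type*} [DecidableEq α] [DecidableEq β] (g : α → β) {n : ℕ}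
    (φ : L.BoundedFormula α n) :
    (φ.relabel (Sum.inl ∘ g : α → β ⊕ Fin 0)).freeVarFinset ⊆ φ.freeVarFinset.image g := by
  have key : ∀ {k : ℕ} (t : L.Term (α ⊕ Fin k)),
      (t.relabel (FirstOrder.Language.BoundedFormula.relabelAux (Sum.inl ∘ g : α → β ⊕ Fin 0) k)).varFinsetLeft
        ⊆ t.varFinsetLeft.image g := by
    intro k t
    refine varFinsetLeft_relabel _ _ _ ?_
    rintro (a | a) b hab (⟨a', ha', haa⟩ | hr)
    · simp only [Sum.inl.injEq] at haa
      subst haa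
      simp only [FirstOrder.Language.BoundedFormula.relabelAux, Function.comp_apply, Sum.map_inl,
        Equiv.sumAssoc_apply_inl_inl, id, Sum.inl.injEq] at hab
      exact Finset.mem_image.2 ⟨a, ha', hab⟩
    · simp at hr
    · simp at haa
    -- A bound variable is never sent to a free one.
    · simp [FirstOrder.Language.BoundedFormula.relabelAux] at hab
  induction φ with
  | falsum => simp
  | equal t₁ t₂ =>
    rw [FirstOrder.Language.BoundedFormula.freeVarFinset, Finset.image_union]
    exact Finset.union_subset_union (key _) (key _)
  | rel R ts =>
    rw [FirstOrder.Language.BoundedFormula.freeVarFinset, Finset.biUnion_image]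
    exact Finset.biUnion_mono fun i _ => key _
  | imp _ _ ih₁ ih₂ =>
    rw [FirstOrder.Language.BoundedFormula.freeVarFinset, Finset.image_union]
    exact Finset.union_subset_union ih₁ ih₂
  | all _ ih =>
    rw [FirstOrder.Language.BoundedFormula.relabel_all]
    exact ih

theorem varFinset_relabel {α β : Type*} [DecidableEq α] [DecidableEq β] (g : α → β)
    (t : L.Term α) : (t.relabel g).varFinset = t.varFinset.image g := by
  induction t with
  | var => simp [FirstOrder.Language.Term.relabel, FirstOrder.Language.Term.varFinset]
  | func _ _ ih =>
    simp [FirstOrder.Language.Term.relabel, FirstOrder.Language.Term.varFinset, Finset.biUnion_image, ih]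

theorem eqOn_varFinset_of_relabel_eq {α β : Type*} [DecidableEq α] {f g : α → β}
    (t : L.Term α) (h : t.relabel f = t.relabel g) : ∀ y ∈ t.varFinset, f y = g y := by
  induction t with
  | var =>
    simp only [FirstOrder.Language.Term.relabel, FirstOrder.Language.Term.var.injEq] at h
    simpa [FirstOrder.Language.Term.varFinset] using h
  | func _ _ ih =>
    simp only [FirstOrder.Language.Term.relabel, FirstOrder.Language.Term.func.injEq, heq_eq_eq, true_and] at h
    simp only [FirstOrder.Language.Term.varFinset, Finset.mem_biUnion, Finset.mem_univ, true_and]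
    rintro y ⟨i, hi⟩
    exact ih i (congrFun h i) y hi

theorem realize_congr_freeVarFinset {M : Type w} [L.Structure M] {α : Type*} [DecidableEq α]
    (φ : L.Formula α) {val val' : α → M} (h : ∀ y ∈ φ.freeVarFinset, val y = val' y) :
    φ.Realize val ↔ φ.Realize val' := by
  have h₁ := FirstOrder.Language.BoundedFormula.realize_restrictFreeVar' (φ := φ)
    (s := φ.freeVarFinset) le_rfl (v := val) (xs := default)
  have h₂ := FirstOrder.Language.BoundedFormula.realize_restrictFreeVar' (φ := φ)
    (s := φ.freeVarFinset) le_rfl (v := val') (xs := default)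
  have : (val ∘ (Subtype.val : ((φ.freeVarFinset : Finset α) : Set α) → α)) =
      val' ∘ Subtype.val := funext fun y => h y y.2
  rw [this] at h₁
  exact h₁.symm.trans h₂

end Formulas

/-! ### Entailment and constraint-compactness. -/

namespace Constraint

variable {L : FirstOrder.Language.{u, v}} {M : Type w} [L.Structure M] {D : ConstraintDomain L M}

instance : Nonempty D.Constraint := ⟨true⟩

theorem Entails.refl (c : D.Constraint) : Entails c c := fun _ h => h

theorem Entails.trans {a b c : D.Constraint} (h : Entails a b) (h' : Entails b c) :
    Entails a c := fun val hv => h' val (h val hv)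

theorem sat_rename (ρ : Equiv.Perm ℕ) (c : D.Constraint) (val : ℕ → M) :
    Sat (rename ρ c) val ↔ Sat c (val ∘ ρ) :=
  FirstOrder.Language.Formula.realize_relabel

theorem sat_and (c c' : D.Constraint) (val : ℕ → M) :
    Sat (and c c') val ↔ Sat c val ∧ Sat c' val :=
  FirstOrder.Language.Formula.realize_inf

theorem sat_eqn (s t : L.Term ℕ) (val : ℕ → M) :
    Sat (D := D) (eqn s t) val ↔ s.realize val = t.realize val :=
  FirstOrder.Language.Formula.realize_equal

theorem sat_conj (cs : List D.Constraint) (val : ℕ → M) :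
    Sat (conj cs) val ↔ ∀ c ∈ cs, Sat c val := by
  induction cs with
  | nil => simp [conj, true, Sat]
  | cons c cs ih =>
    rw [List.forall_mem_cons, ← ih]
    exact sat_and _ _ _

theorem sat_congr (c : D.Constraint) {val val' : ℕ → M} (h : ∀ y ∈ vars c, val y = val' y) :
    Sat c val ↔ Sat c val' :=
  realize_congr_freeVarFinset _ h

theorem vars_rename_subset (ρ : Equiv.Perm ℕ) (c : D.Constraint) :
    vars (rename ρ c) ⊆ (vars c).image ρ :=
  freeVarFinset_relabel _ _

theorem entails_of_rename {a b : D.Constraint} {ρ : Equiv.Perm ℕ}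
    (h : Entails (Constraint.rename ρ a) (Constraint.rename ρ b)) : Entails a b := fun val hv => by
  have := h (val ∘ ρ.symm) ((sat_rename _ _ _).2 (by simpa [Function.comp_assoc] using hv))
  simpa [sat_rename, Function.comp_assoc] using this

theorem rename_entails_rename (c : D.Constraint) {ρ σ : Equiv.Perm ℕ}
    (h : ∀ y ∈ vars c, ρ y = σ y) : Entails (Constraint.rename ρ c) (Constraint.rename σ c) :=
  fun val hv => (sat_rename _ _ _).2 <|
    (sat_congr c fun y hy => by simp [h y hy]).1 ((sat_rename _ _ _).1 hv)

/-- A constraint-compact set contains no sequence over finitely many variables none of whose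
members entails an earlier one. -/
theorem Compact.exists_entails_of_infinite {A : Set D.Constraint} (hA : Compact A) (S : Finset ℕ)
    {T : Set ℕ} (hT : T.Infinite) (f : ℕ → D.Constraint) (hf : ∀ n ∈ T, f n ∈ A)
    (hS : ∀ n ∈ T, vars (f n) ⊆ S) : ∃ m ∈ T, ∃ n ∈ T, m < n ∧ Entails (f n) (f m) := by
  obtain ⟨F, hFC, hF, hcov⟩ := hA S (f '' T) (Set.image_subset_iff.2 hf) (by simpa using hS)
  choose! j hjT hfj using fun c (hc : c ∈ F) => hFC hc
  obtain ⟨b, hb⟩ := (hF.image j).bddAbove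
  -- `b` bounds the chosen indices of the members of the finite cover, so whatever covers `f n`
  -- occurs earlier in the sequence.
  obtain ⟨n, hn, hbn⟩ := hT.exists_gt b
  obtain ⟨c, hc, hent⟩ := hcov (f n) ⟨n, hn, rfl⟩
  exact ⟨j c, hjT c hc, n, hn, (hb ⟨c, hc, rfl⟩).trans_lt hbn, by rwa [hfj c hc]⟩

/-- A set of constraints is constraint-compact if it is finite up to equivalence. -/
theorem compact_of_finite_index {A : Set D.Constraint} {ι : Type*} (s : Set ι) (hs : s.Finite)
    (r : ι → D.Constraint → Prop) (hr : ∀ c ∈ A, ∃ i ∈ s, r i c)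
    (hent : ∀ i ∈ s, ∀ c ∈ A, ∀ c' ∈ A, r i c → r i c' → Entails c c') : Compact A := by
  intro S C hC _
  -- The cover must lie inside `C`: one representative for each index that `C` meets.
  choose! g hgC hg using fun i (hi : ∃ c ∈ C, r i c) => hi
  refine ⟨g '' {i ∈ s | ∃ c ∈ C, r i c}, Set.image_subset_iff.2 fun i hi => hgC i hi.2,
    (hs.sep _).image g, fun c hc => ?_⟩
  obtain ⟨i, hi, hic⟩ := hr c (hC hc)
  exact ⟨g i, ⟨i, ⟨hi, c, hc, hic⟩, rfl⟩,
    hent i hi c (hC hc) _ (hC (hgC i ⟨c, hc, hic⟩)) hic (hg i ⟨c, hc, hic⟩)⟩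

end Constraint

variable {L : FirstOrder.Language.{u, v}} {M : Type w} [L.Structure M]
  {D : ConstraintDomain L M} {Pred : Type x} {ar : Pred → ℕ}

/-! ### Variants of literals and call entailment. -/

namespace Literal

theorem rename_rename (ρ σ : Equiv.Perm ℕ) (t : Literal L ar) :
    (t.rename ρ).rename σ = t.rename (ρ.trans σ) := by
  simp [Literal.rename, Function.comp_def]

theorem rename_refl (t : Literal L ar) : t.rename (Equiv.refl ℕ) = t := by
  simp [Literal.rename]

theorem vars_rename (ρ : Equiv.Perm ℕ) (t : Literal L ar) :
    (t.rename ρ).vars = t.vars.image ρ := by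
  ext y
  simp only [Literal.vars, Literal.rename, varFinset_relabel, Finset.mem_biUnion, Finset.mem_image]
  grind

theorem eqOn_vars_of_rename_eq {ρ σ : Equiv.Perm ℕ} {t : Literal L ar}
    (h : t.rename ρ = t.rename σ) : ∀ y ∈ t.vars, ρ y = σ y := by
  simp only [Literal.rename, Literal.mk.injEq, heq_eq_eq, true_and] at h
  simp only [Literal.vars, Finset.mem_biUnion, Finset.mem_univ, true_and]
  rintro y ⟨i, hi⟩
  exact eqOn_varFinset_of_relabel_eq _ (congrFun h i) y hi

/-- A renaming that takes `t` to a given variant is determined only on `t.vars`. One call may thus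
yield many renamed stores, but they are all equivalent. -/
theorem proj_rename_entails {ρ σ : Equiv.Perm ℕ} {t : Literal L ar}
    (h : t.rename ρ = t.rename σ) (c : D.Constraint) :
    Constraint.Entails (Constraint.rename ρ (D.proj t.vars c))
      (Constraint.rename σ (D.proj t.vars c)) :=
  Constraint.rename_entails_rename _ fun y hy =>
    eqOn_vars_of_rename_eq h y (D.proj_vars _ _ hy)

theorem vars_rename_proj_subset (ρ : Equiv.Perm ℕ) (t : Literal L ar) (c : D.Constraint) :
    Constraint.vars (Constraint.rename ρ (D.proj t.vars c)) ⊆ (t.rename ρ).vars := by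
  rw [vars_rename]
  exact (Constraint.vars_rename_subset _ _).trans (Finset.image_subset_image (D.proj_vars _ _))

end Literal

/-- Any finite set of variables can be renamed apart from any other. -/
theorem exists_perm_disjoint_image (A B : Finset ℕ) :
    ∃ σ : Equiv.Perm ℕ, Disjoint (A.image σ) B := by
  obtain ⟨b, hb⟩ := (A ∪ B).bddAbove
  -- The permutation swaps the block `0..b` with the block `b+1..2b+1`.
  have hinv : Function.Involutive fun n : ℕ =>
      if n ≤ b then n + (b + 1) else if n ≤ b + (b + 1) then n - (b + 1) else n := by
    intro n
    grind
  refine ⟨hinv.toPerm, Finset.disjoint_left.2 fun y hy hyB => ?_⟩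
  obtain ⟨z, hz, rfl⟩ := Finset.mem_image.1 hy
  have hzb : z ≤ b := hb (by simp [hz])
  have := hb (Finset.mem_coe.2 (Finset.mem_union_right A hyB))
  simp only [Function.Involutive.coe_toPerm, if_pos hzb] at this
  omega

/-- Compactness compares projected stores renamed to a common variant `g₀`, whereas steps test
`CallEntails`. A solution of `c` and of the equations takes equal values at corresponding variables
of `t` and of the fresh copy of `g`. As `cg` involves only variables of `g`, the entailment over
`g₀` carries over to that copy. -/
theorem callEntails_of_entails {t g g₀ : Literal L ar} {c cg : D.Constraint}
    {τ γ : Equiv.Perm ℕ} (ht : t.rename τ = g₀) (hg : g.rename γ = g₀)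
    (hcg : Constraint.vars cg ⊆ g.vars)
    (h : Constraint.Entails (Constraint.rename τ (D.proj t.vars c)) (Constraint.rename γ cg)) :
    CallEntails t c g cg := by
  obtain ⟨σ, hσ⟩ := exists_perm_disjoint_image g.vars (t.vars ∪ Constraint.vars c)
  -- The renaming passes from `t` to `g₀`, back to `g`, and on to its fresh copy.
  refine ⟨σ, τ.trans (γ.symm.trans σ), ?_, by rwa [Literal.vars_rename], fun val hval => ?_⟩
  · rw [← Literal.rename_rename, ht, ← hg, Literal.rename_rename, ← Equiv.trans_assoc,
      Equiv.self_trans_symm, Equiv.refl_trans]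
  · obtain ⟨hc, heq⟩ := (Constraint.sat_and _ _ _).1 hval
    have heq' : ∀ y ∈ t.vars, val y = val (σ (γ.symm (τ y))) := fun y hy => by
      have := (Constraint.sat_conj _ _).1 heq _
        (List.mem_map_of_mem (Finset.mem_toList.2 hy))
      simpa [Constraint.sat_eqn] using this
    have hproj := h (val ∘ τ.symm) ((Constraint.sat_rename _ _ _).2 <| by
      rw [Function.comp_assoc, Equiv.symm_comp_self]
      exact D.proj_of_solution t.vars c val hc)
    rw [Constraint.sat_rename] at hproj ⊢
    refine (Constraint.sat_congr cg fun z hz => ?_).1 hproj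
    have hmem : γ z ∈ t.vars.image τ := by
      rw [← Literal.vars_rename, ht, ← hg, Literal.vars_rename]
      exact Finset.mem_image_of_mem _ (hcg hz)
    obtain ⟨y, hy, hyz⟩ := Finset.mem_image.1 hmem
    change val (τ.symm (γ z)) = val (σ z)
    rw [← hyz, τ.symm_apply_apply, heq' y hy, hyz, γ.symm_apply_apply]

theorem Node.Calls.unique {N : Node D ar} {t t' : Literal L ar} (h : N.Calls t)
    (h' : N.Calls t') : t = t' := by
  rcases h with ⟨_, _, h⟩ | ⟨_, _, _, h⟩ <;> rcases h' with ⟨_, _, h'⟩ | ⟨_, _, _, h'⟩ <;>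
    simp_all

/-! ### Terminating executions have constraint-compact sets. -/

section Terminating

variable {P : Program D ar} {Q : Multiset (Literal L ar)} {cq : D.Constraint}
  {E : ℕ → Config D ar}

theorem IsExecution.eq_of_final (hE : IsExecution P Q cq E) {n : ℕ} (hn : Final P (E n)) {m : ℕ}
    (hm : n ≤ m) : E m = E n := by
  induction m, hm using Nat.le_induction with
  | base => rfl
  | succ m _ ih =>
    rcases hE.next m with h | ⟨_, h⟩
    · rw [ih] at h
      exact (hn _ h).elim
    · rw [h, ih]

theorem IsExecution.finite_forest (hE : IsExecution P Q cq E) (hT : Terminates P E) :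
    (forest E).Finite := by
  obtain ⟨n, hn⟩ := hT
  refine ((Finset.range (n + 1)).finite_toSet.biUnion
    fun m _ => (E m).nodes.finite_toSet).subset ?_
  rintro N ⟨m, hm⟩
  rcases le_total m n with h | h
  · exact Set.mem_biUnion (by simp; omega) hm
  · rw [hE.eq_of_final hn h] at hm
    exact Set.mem_biUnion (x := n) (by simp) hm

theorem compact_callStores_of_finite (hF : (forest E).Finite) (g : Literal L ar) :
    Constraint.Compact (callStores E g) := by
  refine Constraint.compact_of_finite_index (forest E) hF
    (fun N c => ∃ t, N.Calls t ∧ ∃ ρ : Equiv.Perm ℕ, t.rename ρ = g ∧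
      c = Constraint.rename ρ (D.proj t.vars N.state.store)) (fun c hc => hc) ?_
  rintro N - c - c' - ⟨t, ht, ρ, hρ, rfl⟩ ⟨t', ht', ρ', hρ', rfl⟩
  obtain rfl := ht.unique ht'
  exact Literal.proj_rename_entails (hρ.trans hρ'.symm) _

theorem compact_answerStores_of_finite (hF : (forest E).Finite) (g : Literal L ar)
    (cg : D.Constraint) : Constraint.Compact (answerStores E g cg) := by
  refine Constraint.compact_of_finite_index (forest E) hF
    (fun N a => ∃ t c, N.root = ⟨{.lit t}, c⟩ ∧ ∃ ρ : Equiv.Perm ℕ, t.rename ρ = g ∧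
      a = Constraint.rename ρ (D.proj t.vars N.state.store)) ?_ ?_
  · rintro a ⟨N, hN, t, c, hroot, -, ρ, hρ, -, ha⟩
    exact ⟨N, hN, t, c, hroot, ρ, hρ, ha⟩
  · rintro N - a - a' - ⟨t, c, hroot, ρ, hρ, rfl⟩ ⟨t', c', hroot', ρ', hρ', rfl⟩
    rw [hroot] at hroot'
    simp only [State.mk.injEq, Multiset.singleton_inj, Item.lit.injEq] at hroot'
    obtain ⟨rfl, -⟩ := hroot'
    exact Literal.proj_rename_entails (hρ.trans hρ'.symm) _

end Terminating
-- A rank that decreases while the generators are unchanged.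
/-- The literals of a resolvent all satisfy `V`. -/
def LitsIn (V : Literal L ar → Prop) (R : Multiset (Item D ar)) : Prop :=
  ∀ t, Item.lit t ∈ R → V t

theorem LitsIn.of_cons {V : Literal L ar → Prop} {a : Item D ar} {R : Multiset (Item D ar)}
    (h : LitsIn V (a ::ₘ R)) : LitsIn V R := fun t ht => h t (Multiset.mem_cons_of_mem ht)

/-- The literals that remain to be solved at a node satisfy `V`, and the clauses that remain to be
tried belong to the program. -/
def Work.WellFormed (P : Program D ar) (V : Literal L ar → Prop) : Work D ar → Prop
  | .fresh => True
  | .resolving _ R pending => LitsIn V R ∧ ∀ cl ∈ pending, cl ∈ P.clauses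
  | .consuming _ R _ _ => LitsIn V R
  | .done => True

namespace Program

variable (P : Program D ar)

theorem mem_of_mem_clausesFor {t : Literal L ar} {cl : Clause D ar} (h : cl ∈ P.clausesFor t) :
    cl ∈ P.clauses := by
  simp only [clausesFor, Multiset.mem_coe, List.mem_filter] at h
  exact h.1

/-- The number of predicates that `p` reaches through predicates that are not tabled. -/
noncomputable def rank (p : Pred) : ℕ := {q | Relation.TransGen P.UntabledCall p q}.ncard

theorem finite_transGen_untabledCall (p : Pred) :
    {q | Relation.TransGen P.UntabledCall p q}.Finite := by
  refine ((P.clauses.flatMap fun cl => cl.body.map Literal.pred).finite_toSet).subset ?_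
  intro q hq
  obtain ⟨p', -, -, -, cl, hcl, -, l, hl, rfl⟩ := Relation.TransGen.tail'_iff.1 hq
  simp only [Set.mem_ofPred_eq, List.mem_flatMap, List.mem_map]
  exact ⟨cl, hcl, l, hl, rfl⟩

variable {P}

/-- What `q` reaches, `p` reaches too. The inclusion is strict because `p` reaches `q`, while `q`
does not reach itself. -/
theorem RecursionTabled.rank_lt (hP : P.RecursionTabled) {p q : Pred} (h : P.UntabledCall p q) :
    P.rank q < P.rank p := by
  refine Set.ncard_lt_ncard ⟨fun r hr => Relation.TransGen.head h hr, fun hsub => ?_⟩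
    (P.finite_transGen_untabledCall p)
  exact hP q (hsub (Relation.TransGen.single h))

variable (P)

open Classical in
/-- The weight of an element of a resolvent. -/
noncomputable def weight : Item D ar → WithTop ℕ
  | .con _ => 0
  | .lit t => if t.pred ∈ P.tab then 1 else ((P.rank t.pred + 2 : ℕ) : WithTop ℕ)

open Classical in
/-- The weight of a literal that is being resolved against clauses. -/
noncomputable def selectedWeight (t : Literal L ar) : WithTop ℕ :=
  if t.pred ∈ P.tab then ⊤ else P.weight (.lit t)

theorem zero_lt_selectedWeight (t : Literal L ar) : 0 < P.selectedWeight t := by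
  by_cases h : t.pred ∈ P.tab <;> simp only [selectedWeight, weight, h, if_true, if_false]
  · simp
  · exact WithTop.coe_lt_coe.2 (Nat.succ_pos _)

variable {P}

/-- Resolution replaces a literal by lighter ones. The summand 2 in `weight` keeps an untabled
literal above the weight 1 of a tabled one even at rank 0. A tabled literal is resolved against
clauses only at the root of a generator tree; its body may then be arbitrarily heavy, hence `⊤`. -/
theorem RecursionTabled.weight_lt_selectedWeight (hP : P.RecursionTabled) {t l : Literal L ar}
    {cl : Clause D ar} (hcl : cl ∈ P.clauses) (ht : t.pred = cl.pred)
    (hl : l.pred ∈ cl.body.map Literal.pred) : P.weight (.lit l) < P.selectedWeight t := by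
  obtain ⟨l', hl', hll'⟩ := List.mem_map.1 hl
  by_cases h₁ : t.pred ∈ P.tab <;> by_cases h₂ : l.pred ∈ P.tab <;>
    simp only [selectedWeight, weight, h₁, h₂, if_true, if_false]
  · exact WithTop.coe_lt_top 1
  · exact WithTop.coe_lt_top _
  · norm_cast
    omega
  · have := hP.rank_lt ⟨h₁, h₂, cl, hcl, ht.symm, l', hl', hll'⟩
    norm_cast
    omega

variable (P)

/-- The number of answers of the `k`-th generator that are not in `used`. -/
noncomputable def unusedAnswers (gens : List (Generator D ar)) (k : ℕ)
    (used : Set D.Constraint) : ℕ :=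
  {a | (∃ G, gens[k]? = some G ∧ a ∈ G.answers) ∧ a ∉ used}.ncard

theorem unusedAnswers_insert_lt {gens : List (Generator D ar)} {k : ℕ} {G : Generator D ar}
    (hG : gens[k]? = some G) {a : D.Constraint} (ha : a ∈ G.answers) {used : Set D.Constraint}
    (hused : a ∉ used) : unusedAnswers gens k (insert a used) < unusedAnswers gens k used := by
  refine Set.ncard_lt_ncard ⟨fun b hb => ⟨hb.1, fun h => hb.2 (Or.inr h)⟩, fun hsub => ?_⟩
    (G.answers.finite_toSet.subset ?_)
  · exact (hsub ⟨⟨G, hG, ha⟩, hused⟩).2 (Or.inl rfl)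
  · rintro b ⟨⟨G', hG', hb⟩, -⟩
    obtain rfl := Option.some_injective _ (hG.symm.trans hG')
    exact hb

/-- The weights of what remains to be solved at a node, and the number of children that it still
can get from its current generators. -/
noncomputable def nodeRank (gens : List (Generator D ar)) (N : Node D ar) :
    Multiset (WithTop ℕ) × WithTop ℕ :=
  match N.work with
  -- Selecting an element keeps the first component and lowers this `⊤` to a finite number.
  | .fresh => (N.state.resolvent.map P.weight, ⊤)
  | .resolving t R pending =>
    (P.selectedWeight t ::ₘ R.map P.weight, ((Multiset.card pending : ℕ) : WithTop ℕ))
  | .consuming t R k used =>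
    (P.weight (.lit t) ::ₘ R.map P.weight, ((unusedAnswers gens k used : ℕ) : WithTop ℕ))
  | .done => (N.state.resolvent.map P.weight, 0)

end Program

/-- The order in which the ranks of nodes decrease. -/
def RankLT : Multiset (WithTop ℕ) × WithTop ℕ → Multiset (WithTop ℕ) × WithTop ℕ → Prop :=
  Prod.Lex (Relation.CutExpand (· < ·)) (· < ·)

theorem wellFounded_rankLT : WellFounded RankLT :=
  WellFounded.prod_lex (WellFounded.cutExpand wellFounded_lt) wellFounded_lt

/-- This is the shape of a step: one node is updated, its children are appended, and all of these
have smaller rank than the old node. -/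
theorem cutExpand_map_set {α β : Type*} {r : β → β → Prop} (f : α → β) {l : List α} {i : ℕ}
    {a a' : α} (hi : l[i]? = some a) {new : List α} (ha' : r (f a') (f a))
    (hnew : ∀ b ∈ new, r (f b) (f a)) :
    Relation.CutExpand r (((l.set i a' ++ new : List α) : Multiset α).map f)
      ((l : Multiset α).map f) := by
  obtain ⟨hlt, rfl⟩ := List.getElem?_eq_some_iff.1 hi
  refine ⟨(f a' ::ₘ (new : Multiset α).map f), f l[i], ?_, ?_⟩
  · simpa using ⟨ha', hnew⟩
  · have h₁ : l = l.take i ++ l[i] :: l.drop (i + 1) := by simp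
    rw [List.set_eq_take_append_cons_drop, if_pos hlt]
    conv_rhs => rw [h₁]
    simp only [← Multiset.coe_add, ← Multiset.cons_coe, Multiset.map_add, ← Multiset.singleton_add,
      Multiset.map_singleton]
    abel

variable {P : Program D ar}

theorem cutExpand_remove (a : WithTop ℕ) (s : Multiset (WithTop ℕ)) :
    Relation.CutExpand (· < ·) s (a ::ₘ s) := ⟨0, a, by simp, by
  rw [add_zero, add_comm, Multiset.singleton_add]⟩

/-- A step that leaves the generators as they are decreases the ranks of the nodes. -/
theorem Step.cutExpand_nodeRank (hP : P.RecursionTabled) {V : Literal L ar → Prop}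
    {K K' : Config D ar} (h : Step P K K') (hK : ∀ N ∈ K.nodes, N.work.WellFormed P V)
    (hgens : K'.gens = K.gens) :
    Relation.CutExpand RankLT ((K'.nodes : Multiset (Node D ar)).map (P.nodeRank K'.gens))
      ((K.nodes : Multiset (Node D ar)).map (P.nodeRank K.gens)) := by
  rw [hgens]
  have hcons : ∀ {N : Node D ar} {R : Multiset (Item D ar)} {c : D.Constraint} {p},
      Relation.CutExpand (· < ·) (R.map P.weight) p.1 →
      ∀ N' ∈ N.childIfConsistent R c, RankLT (P.nodeRank K.gens N') p := by
    intro N R c p hp N' hN'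
    simp only [Node.childIfConsistent] at hN'
    split_ifs at hN'
    · obtain rfl := List.mem_singleton.1 hN'
      exact Prod.lex_def.2 (Or.inl hp)
    · simp at hN'
  cases h with
  | constraint hN hw hR =>
    refine cutExpand_map_set _ hN (Prod.lex_def.2 (Or.inr ?_)) (hcons ?_)
    · simp [Program.nodeRank, hw, Node.withWork]
    · simp only [Program.nodeRank, hw, hR, Multiset.map_cons]
      exact cutExpand_remove _ _
  | untabled hN hw hR ht =>
    refine cutExpand_map_set _ hN (Prod.lex_def.2 (Or.inr ?_)) (by simp)
    simp [Program.nodeRank, hw, hR, Node.withWork, Program.selectedWeight, ht]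
  | consumer hN hw hR ht hG hent hold =>
    refine cutExpand_map_set _ hN (Prod.lex_def.2 (Or.inr ?_)) (by simp)
    simp [Program.nodeRank, hw, hR, Node.withWork]
  | generator hN hw hR ht hnew =>
    -- A new generator lengthens the list.
    simp at hgens
  | @resolve i N t R pending cl ρ hN hw hcl hfresh =>
    refine cutExpand_map_set _ hN (Prod.lex_def.2 (Or.inr ?_)) ?_
    · simp only [Program.nodeRank, hw, Node.withWork, Multiset.card_cons, true_and]
      exact_mod_cast Nat.lt_succ_self _
    · simp only [List.mem_singleton, forall_eq]
      refine Prod.lex_def.2 (Or.inl ?_)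
      simp only [Program.nodeRank, hw, Node.child, Multiset.map_add, Multiset.map_cons]
      have hmem := hK N (List.mem_of_getElem? hN)
      rw [hw] at hmem
      have hclP : cl ∈ P.clauses := hmem.2 cl (by simp)
      -- The weight of `t` is traded for those of the two constraints and of the clause body.
      refine ⟨P.weight (.con ((cl.rename ρ).headEqn t hcl)) ::ₘ
          P.weight (.con (cl.rename ρ).con) ::ₘ Multiset.map P.weight
            (((cl.rename ρ).body.map Item.lit : List (Item D ar)) : Multiset (Item D ar)),
        P.selectedWeight t, ?_, ?_⟩
      · simp only [Multiset.mem_cons, Multiset.mem_map, Multiset.mem_coe, List.mem_map]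
        rintro a (rfl | rfl | ⟨_, ⟨l, hl, rfl⟩, rfl⟩)
        · exact P.zero_lt_selectedWeight t
        · exact P.zero_lt_selectedWeight t
        · refine hP.weight_lt_selectedWeight hclP hcl ?_
          obtain ⟨l', hl', rfl⟩ := List.mem_map.1 hl
          exact List.mem_map.2 ⟨l', hl', rfl⟩
      · simp only [← Multiset.singleton_add]
        abel
  | consume ρ hN hw hG ha hused hρ =>
    refine cutExpand_map_set _ hN (Prod.lex_def.2 (Or.inr ?_)) (hcons ?_)
    · simp only [Program.nodeRank, hw, Node.withWork, true_and]
      exact_mod_cast Program.unusedAnswers_insert_lt hG ha hused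
    · simp only [Program.nodeRank, hw]
      exact cutExpand_remove _ _
  | @answer i N k G hN hw hR hk hG =>
    -- This case remains because an answer may be discarded, leaving the generators unchanged.
    have := cutExpand_map_set (r := RankLT) (P.nodeRank K.gens) (a' := N.withWork .done) hN
      (new := []) (Prod.lex_def.2 (Or.inr ?_)) (by simp)
    · simpa using this
    · simp [Program.nodeRank, hw, Node.withWork]
  | queryAnswer hN hw hR hk =>
    refine cutExpand_map_set _ hN (Prod.lex_def.2 (Or.inr ?_)) (by simp)
    simp [Program.nodeRank, hw, Node.withWork]

/-- An infinite sequence of steps changes the generators infinitely often. -/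
theorem exists_gens_ne (hP : P.RecursionTabled) {V : Literal L ar → Prop} {E : ℕ → Config D ar}
    (hstep : ∀ n, Step P (E n) (E (n + 1)))
    (hwf : ∀ n, ∀ N ∈ (E n).nodes, N.work.WellFormed P V) (n : ℕ) :
    ∃ m ≥ n, (E (m + 1)).gens ≠ (E m).gens := by
  by_contra! hcon
  refine (wellFounded_iff_isEmpty_descending_chain.1 wellFounded_rankLT.cutExpand).false
    ⟨fun m => ((E (n + m)).nodes : Multiset (Node D ar)).map (P.nodeRank (E (n + m)).gens),
      fun m => ?_⟩
  exact (hstep (n + m)).cutExpand_nodeRank hP (hwf _) (hcon _ (by omega))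

/-! ### Invariants of the forest and of the generators. -/

/-- The literals from which those of an evaluation arise by renaming. -/
def Program.sourceLiterals (P : Program D ar) (Q : Multiset (Literal L ar)) :
    Set (Literal L ar) :=
  {b | b ∈ Q} ∪ {b | ∃ cl ∈ P.clauses, b ∈ cl.body}

theorem Program.finite_sourceLiterals (P : Program D ar) (Q : Multiset (Literal L ar)) :
    (P.sourceLiterals Q).Finite := by
  classical
  refine Set.Finite.union (Q.toFinset.finite_toSet.subset fun b hb => by simpa using hb) ?_
  refine ((P.clauses.flatMap Clause.body).finite_toSet).subset ?_
  rintro b ⟨cl, hcl, hb⟩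
  exact List.mem_flatMap.2 ⟨cl, hcl, hb⟩

/-- `t` is a variant of a literal of the program or of the query. -/
def Program.Occurs (P : Program D ar) (Q : Multiset (Literal L ar)) (t : Literal L ar) : Prop :=
  ∃ b ∈ P.sourceLiterals Q, ∃ ρ : Equiv.Perm ℕ, b.rename ρ = t

/-- What holds at the nodes of a forest with the generators `gens`. -/
structure Node.WellFormed (P : Program D ar) (V : Literal L ar → Prop)
    (gens : List (Generator D ar)) (N : Node D ar) : Prop where
  resolvent : LitsIn V N.state.resolvent
  work : N.work.WellFormed P V
  root : ∀ k, N.gen = some k →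
    ∃ G, gens[k]? = some G ∧ N.root = ⟨{.lit G.lit}, G.store⟩

/-- The generators of `gens` persist in `gens'`, possibly with other answers. -/
def Persist (gens gens' : List (Generator D ar)) : Prop :=
  ∀ (k : ℕ) (G : Generator D ar), gens[k]? = some G → ∃ G' : Generator D ar,
    gens'[k]? = some G' ∧ G'.lit = G.lit ∧ G'.store = G.store

theorem Persist.refl (gens : List (Generator D ar)) : Persist gens gens :=
  fun _ G hG => ⟨G, hG, rfl, rfl⟩

theorem Persist.trans {g₁ g₂ g₃ : List (Generator D ar)} (h : Persist g₁ g₂)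
    (h' : Persist g₂ g₃) : Persist g₁ g₃ := fun k G hG => by
  obtain ⟨G', hG', hl, hs⟩ := h k G hG
  obtain ⟨G'', hG'', hl', hs'⟩ := h' k G' hG'
  exact ⟨G'', hG'', hl'.trans hl, hs'.trans hs⟩

theorem persist_append (gens new : List (Generator D ar)) : Persist gens (gens ++ new) :=
  fun k G hG => ⟨G, by
    rw [List.getElem?_append_left (List.getElem?_eq_some_iff.1 hG).1, hG], rfl, rfl⟩

theorem persist_set {gens : List (Generator D ar)} {k : ℕ} {G : Generator D ar}
    (hG : gens[k]? = some G) (as : List D.Constraint) :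
    Persist gens (gens.set k ⟨G.lit, G.store, as⟩) := by
  intro j G' hG'
  by_cases hjk : k = j
  · subst hjk
    obtain rfl := Option.some_injective _ (hG.symm.trans hG')
    exact ⟨_, List.getElem?_set_self (List.getElem?_eq_some_iff.1 hG).1, rfl, rfl⟩
  · exact ⟨G', by rwa [List.getElem?_set_ne hjk], rfl, rfl⟩

theorem Node.WellFormed.persist {P : Program D ar} {V : Literal L ar → Prop}
    {gens gens' : List (Generator D ar)} {N : Node D ar} (h : N.WellFormed P V gens)
    (hp : Persist gens gens') : N.WellFormed P V gens' where
  resolvent := h.resolvent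
  work := h.work
  root := fun k hk => by
    obtain ⟨G, hG, hr⟩ := h.root k hk
    obtain ⟨G', hG', hl, hs⟩ := hp k G hG
    exact ⟨G', hG', by rw [hr, hl, hs]⟩

theorem Node.WellFormed.withWork {P : Program D ar} {V : Literal L ar → Prop}
    {gens : List (Generator D ar)} {N : Node D ar} (h : N.WellFormed P V gens) {W : Work D ar}
    (hW : W.WellFormed P V) : (N.withWork W).WellFormed P V gens :=
  ⟨h.resolvent, hW, h.root⟩

theorem Node.WellFormed.child {P : Program D ar} {V : Literal L ar → Prop}
    {gens : List (Generator D ar)} {N : Node D ar} (h : N.WellFormed P V gens)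
    {R : Multiset (Item D ar)} (hR : LitsIn V R) (c : D.Constraint) :
    (N.child R c).WellFormed P V gens :=
  ⟨hR, trivial, h.root⟩

theorem Node.WellFormed.childIfConsistent {P : Program D ar} {V : Literal L ar → Prop}
    {gens : List (Generator D ar)} {N : Node D ar} (h : N.WellFormed P V gens)
    {R : Multiset (Item D ar)} (hR : LitsIn V R) (c : D.Constraint) :
    ∀ N' ∈ N.childIfConsistent R c, N'.WellFormed P V gens := by
  intro N' hN'
  simp only [Node.childIfConsistent] at hN'
  split_ifs at hN'
  · obtain rfl := List.mem_singleton.1 hN'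
    exact h.child hR c
  · simp at hN'

theorem forall_mem_set_append {α : Type*} {p : α → Prop} {l new : List α} {i : ℕ} {a : α}
    (hl : ∀ b ∈ l, p b) (ha : p a) (hnew : ∀ b ∈ new, p b) : ∀ b ∈ l.set i a ++ new, p b := by
  intro b hb
  rcases List.mem_append.1 hb with hb | hb
  · rcases List.mem_or_eq_of_mem_set hb with hb | rfl
    · exact hl b hb
    · exact ha
  · exact hnew b hb

variable {P : Program D ar} {Q : Multiset (Literal L ar)} {cq : D.Constraint}

theorem Program.occurs_rename_of_mem_body {cl : Clause D ar} (hcl : cl ∈ P.clauses)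
    (ρ : Equiv.Perm ℕ) {t : Literal L ar} (ht : t ∈ (cl.rename ρ).body) : P.Occurs Q t := by
  obtain ⟨b, hb, rfl⟩ := List.mem_map.1 ht
  exact ⟨b, Or.inr ⟨cl, hcl, hb⟩, ρ, rfl⟩

/-- Steps preserve well-formedness. -/
theorem Step.wellFormed {K K' : Config D ar} (h : Step P K K')
    (hK : ∀ N ∈ K.nodes, N.WellFormed P (P.Occurs Q) K.gens) :
    ∀ N ∈ K'.nodes, N.WellFormed P (P.Occurs Q) K'.gens := by
  have hwf : ∀ {i : ℕ} {N : Node D ar}, K.nodes[i]? = some N →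
      N.WellFormed P (P.Occurs Q) K.gens := fun hN => hK _ (List.mem_of_getElem? hN)
  cases h with
  | constraint hN hw hR =>
    have hN' := hwf hN
    have hl := hN'.resolvent
    rw [hR] at hl
    exact forall_mem_set_append hK (hN'.withWork trivial) (hN'.childIfConsistent hl.of_cons _)
  | untabled hN hw hR ht =>
    have hN' := hwf hN
    have hl := hN'.resolvent
    rw [hR] at hl
    exact forall_mem_set_append hK
      (hN'.withWork ⟨hl.of_cons, fun cl hcl => P.mem_of_mem_clausesFor hcl⟩) (by simp)
  | consumer hN hw hR ht hG hent hold =>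
    have hN' := hwf hN
    have hl := hN'.resolvent
    rw [hR] at hl
    exact forall_mem_set_append hK (hN'.withWork hl.of_cons) (by simp)
  | @generator i N t R hN hw hR ht hnew =>
    have hN' := hwf hN
    have hl := hN'.resolvent
    rw [hR] at hl
    refine forall_mem_set_append (fun N' h' => (hK N' h').persist (persist_append _ _))
      ((hN'.persist (persist_append _ _)).withWork hl.of_cons) ?_
    simp only [List.mem_singleton, forall_eq]
    refine ⟨fun t' ht' => ?_, ⟨by simp [LitsIn], fun cl hcl => P.mem_of_mem_clausesFor hcl⟩, ?_⟩
    · simp only [Multiset.mem_singleton, Item.lit.injEq] at ht'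
      exact ht' ▸ hl t (Multiset.mem_cons_self _ _)
    · intro k hk
      obtain rfl := Option.some_injective _ hk
      exact ⟨_, List.getElem?_concat_length, rfl⟩
  | @resolve i N t R pending cl ρ hN hw hcl hfresh =>
    have hN' := hwf hN
    have hW := hN'.work
    rw [hw] at hW
    refine forall_mem_set_append hK
      (hN'.withWork ⟨hW.1, fun cl' h' => hW.2 cl' (Multiset.mem_cons_of_mem h')⟩) ?_
    simp only [List.mem_singleton, forall_eq]
    refine hN'.child (fun t' ht' => ?_) _
    simp only [Multiset.mem_add, Multiset.mem_cons, reduceCtorEq, false_or, Multiset.mem_coe,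
      List.mem_map, Item.lit.injEq, exists_eq_right] at ht'
    rcases ht' with ht' | ht'
    · exact Program.occurs_rename_of_mem_body (hW.2 cl (Multiset.mem_cons_self _ _)) ρ ht'
    · exact hW.1 t' ht'
  | consume ρ hN hw hG ha hused hρ =>
    have hN' := hwf hN
    have hW := hN'.work
    rw [hw] at hW
    exact forall_mem_set_append hK (hN'.withWork hW) (hN'.childIfConsistent hW _)
  | @answer i N k G hN hw hR hk hG =>
    have hN' := (hwf hN).persist
      (persist_set hG (addAnswer G.answers (D.proj G.lit.vars N.state.store)))
    have := forall_mem_set_append (i := i) (new := [])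
      (fun N' h' => (hK N' h').persist
        (persist_set hG (addAnswer G.answers (D.proj G.lit.vars N.state.store))))
      (hN'.withWork (W := .done) trivial) (by simp)
    simpa using this
  | queryAnswer hN hw hR hk =>
    exact forall_mem_set_append hK ((hwf hN).withWork trivial) (by simp)

/-- The generators after a step: they are unchanged, or a generator has been created, or an answer
has been handled. -/
theorem Step.gens_cases {V : Literal L ar → Prop} {K K' : Config D ar} (h : Step P K K')
    (hK : ∀ N ∈ K.nodes, N.WellFormed P V K.gens) :
    K'.gens = K.gens ∨
    (∃ t, V t ∧ ∃ N ∈ K'.nodes, N.Calls t ∧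
      K'.gens = K.gens ++ [⟨t, D.proj t.vars N.state.store, []⟩] ∧
      ∀ G ∈ K.gens, ¬ CallEntails t N.state.store G.lit G.store) ∨
    ∃ k G, K.gens[k]? = some G ∧ ∃ N ∈ K.nodes, N.root = ⟨{.lit G.lit}, G.store⟩ ∧
      N.state.resolvent = 0 ∧ K'.gens = K.gens.set k
        ⟨G.lit, G.store, addAnswer G.answers (D.proj G.lit.vars N.state.store)⟩ := by
  cases h with
  | @generator i N t R hN hw hR ht hnew =>
    -- The calling node is taken after the step: only then does it record that `t` is called.
    refine Or.inr (Or.inl ⟨t, ?_, N.withWork (.consuming t R K.gens.length ∅), ?_,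
      Or.inr ⟨_, _, _, rfl⟩, rfl, hnew⟩)
    · refine (hK N (List.mem_of_getElem? hN)).resolvent t ?_
      rw [hR]
      exact Multiset.mem_cons_self _ _
    · exact List.mem_append_left _ (List.mem_set (List.getElem?_eq_some_iff.1 hN).1 _)
  | @answer i N k G hN hw hR hk hG =>
    have hmem := List.mem_of_getElem? hN
    obtain ⟨G', hG', hroot⟩ := (hK N hmem).root k hk
    obtain rfl := Option.some_injective _ (hG.symm.trans hG')
    exact Or.inr (Or.inr ⟨k, G, hG, N, hmem, hroot, hR, rfl⟩)
  | _ => exact Or.inl rfl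

/-! ### Answers once covered stay covered. -/

/-- The constraint `a` entails an answer kept for the `k`-th generator. -/
def Covered (gens : List (Generator D ar)) (k : ℕ) (a : D.Constraint) : Prop :=
  ∃ G, gens[k]? = some G ∧ ∃ b ∈ G.answers, Constraint.Entails a b

theorem exists_mem_addAnswer_entails (as : List D.Constraint) (a : D.Constraint) :
    ∃ b ∈ addAnswer as a, Constraint.Entails a b := by
  unfold addAnswer
  split_ifs with h
  · exact h
  · exact ⟨a, by simp, .refl a⟩

theorem exists_mem_addAnswer_entails_of_mem {as : List D.Constraint} (a : D.Constraint)
    {b : D.Constraint} (hb : b ∈ as) : ∃ b' ∈ addAnswer as a, Constraint.Entails b b' := by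
  unfold addAnswer
  split_ifs with h
  · exact ⟨b, hb, .refl b⟩
  · by_cases hba : Constraint.Entails b a
    · exact ⟨a, by simp, hba⟩
    · exact ⟨b, by simp [hb, hba], .refl b⟩

theorem addAnswer_eq_self {as : List D.Constraint} {a : D.Constraint}
    (h : ∃ b ∈ as, Constraint.Entails a b) : addAnswer as a = as := if_pos h

theorem Step.persist {V : Literal L ar → Prop} {K K' : Config D ar} (h : Step P K K')
    (hK : ∀ N ∈ K.nodes, N.WellFormed P V K.gens) : Persist K.gens K'.gens := by
  rcases h.gens_cases hK with h | ⟨t, -, N, -, -, h, -⟩ | ⟨k, G, hG, N, -, -, -, h⟩ <;> rw [h]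
  · exact .refl _
  · exact persist_append _ _
  · exact persist_set hG _

/-- A kept answer is removed only in favour of one that it entails, so coverage survives by
transitivity. -/
theorem Step.covered {V : Literal L ar → Prop} {K K' : Config D ar} (h : Step P K K')
    (hK : ∀ N ∈ K.nodes, N.WellFormed P V K.gens) {k : ℕ} {a : D.Constraint}
    (ha : Covered K.gens k a) : Covered K'.gens k a := by
  rcases h.gens_cases hK with h | ⟨t, -, N, -, -, h, -⟩ | ⟨j, G, hG, N, -, -, -, h⟩ <;> rw [h]
  · exact ha
  · obtain ⟨G, hG, hb⟩ := ha
    exact ⟨G, by rw [List.getElem?_append_left (List.getElem?_eq_some_iff.1 hG).1, hG], hb⟩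
  · obtain ⟨G', hG', b, hb, hab⟩ := ha
    by_cases hjk : j = k
    · subst hjk
      obtain rfl := Option.some_injective _ (hG.symm.trans hG')
      obtain ⟨b', hb', hbb'⟩ :=
        exists_mem_addAnswer_entails_of_mem (D.proj G.lit.vars N.state.store) hb
      exact ⟨_, List.getElem?_set_self (List.getElem?_eq_some_iff.1 hG).1, b', hb',
        hab.trans hbb'⟩
    · exact ⟨G', by rwa [List.getElem?_set_ne hjk], b, hb, hab⟩

/-! ### Infinite executions: finitely many generators and changes of answers. -/

section Infinite

variable {E : ℕ → Config D ar}

theorem IsExecution.wellFormed (hE : IsExecution P Q cq E) (n : ℕ) :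
    ∀ N ∈ (E n).nodes, N.WellFormed P (P.Occurs Q) (E n).gens := by
  induction n with
  | zero =>
    rw [hE.start]
    simp only [initial, List.mem_singleton, forall_eq]
    refine ⟨fun t ht => ⟨t, Or.inl ?_, Equiv.refl ℕ, t.rename_refl⟩, trivial, by simp⟩
    simpa [queryState] using ht
  | succ n ih =>
    rcases hE.next n with h | ⟨-, h⟩
    · exact h.wellFormed ih
    · rwa [h]

theorem persist_of_le (hE : IsExecution P Q cq E)
    (hstep : ∀ n, Step P (E n) (E (n + 1))) {m n : ℕ} (hmn : m ≤ n) : Persist (E m).gens (E n).gens := by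
  induction n, hmn using Nat.le_induction with
  | base => exact .refl _
  | succ n _ ih => exact ih.trans ((hstep n).persist (hE.wellFormed n))

theorem covered_of_le (hE : IsExecution P Q cq E)
    (hstep : ∀ n, Step P (E n) (E (n + 1))) {m n : ℕ} (hmn : m ≤ n) {k : ℕ} {a : D.Constraint}
    (ha : Covered (E m).gens k a) : Covered (E n).gens k a := by
  induction n, hmn using Nat.le_induction with
  | base => exact ha
  | succ n _ ih => exact (hstep n).covered (hE.wellFormed n) ih

/-- If the sets of call stores are constraint-compact, then finitely many generators are
created. -/
theorem finite_setOf_length_gens_ne (hE : IsExecution P Q cq E)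
    (hstep : ∀ n, Step P (E n) (E (n + 1)))
    (hC : ∀ g : Literal L ar, Constraint.Compact (callStores E g)) :
    {n | (E (n + 1)).gens.length ≠ (E n).gens.length}.Finite := by
  by_contra hinf
  set T := {n | (E (n + 1)).gens.length ≠ (E n).gens.length} with hT
  have hnew : ∀ n ∈ T, ∃ b ∈ P.sourceLiterals Q, ∃ t, ∃ τ : Equiv.Perm ℕ, t.rename τ = b ∧
      ∃ c, Constraint.rename τ (D.proj t.vars c) ∈ callStores E b ∧
      (E (n + 1)).gens = (E n).gens ++ [⟨t, D.proj t.vars c, []⟩] ∧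
      ∀ G ∈ (E n).gens, ¬ CallEntails t c G.lit G.store := by
    intro n hn
    rcases (hstep n).gens_cases (hE.wellFormed n) with
      h | ⟨t, ⟨b, hb, ρ, rfl⟩, N, hN, hcall, h, hno⟩ | ⟨k, G, hG, N, -, -, -, h⟩
    · exact (hn (by rw [h])).elim
    · have hτ : (b.rename ρ).rename ρ.symm = b := by
        rw [Literal.rename_rename, Equiv.self_trans_symm, Literal.rename_refl]
      exact ⟨b, hb, _, ρ.symm, hτ, _, ⟨N, ⟨n + 1, hN⟩, _, hcall, ρ.symm, hτ, rfl⟩, h, hno⟩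
    · exact (hn (by rw [h, List.length_set])).elim
  have : Nonempty (Literal L ar) := by
    obtain ⟨n, hn⟩ := Set.Infinite.nonempty hinf
    obtain ⟨b, -⟩ := hnew n hn
    exact ⟨b⟩
  choose! b hb t τ ht c hmem hgens hno using hnew
  -- Pigeonhole: infinitely many creations share one of the finitely many source literals.
  obtain ⟨g, hg⟩ : ∃ g, {n ∈ T | b n = g}.Infinite := by
    by_contra! hfin
    refine hinf (((P.finite_sourceLiterals Q).biUnion fun g _ => hfin g).subset fun n hn => ?_)
    exact Set.mem_biUnion (hb n hn) ⟨hn, rfl⟩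
  obtain ⟨m, ⟨hm, hmg⟩, n, ⟨hn, hng⟩, hmn, hent⟩ := (hC g).exists_entails_of_infinite g.vars hg
    (fun n => Constraint.rename (τ n) (D.proj (t n).vars (c n)))
    (fun n hn => hn.2 ▸ hmem n hn.1)
    (fun n hn => by
      have := Literal.vars_rename_proj_subset (τ n) (t n) (c n)
      rwa [ht n hn.1, hn.2] at this)
  -- The generator created at `m` is still there at `n`, and the call at `n` entails it, contrary to
  -- the creation of a generator.
  have hpers := persist_of_le hE hstep (Nat.succ_le_of_lt hmn)
  obtain ⟨G, hG, hl, hs⟩ := hpers (E m).gens.length ⟨t m, D.proj (t m).vars (c m), []⟩ (by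
    rw [Nat.succ_eq_add_one, hgens m hm, List.getElem?_concat_length])
  refine hno n hn G (List.mem_of_getElem? hG) ?_
  rw [hl, hs]
  exact callEntails_of_entails ((ht n hn).trans hng) ((ht m hm).trans hmg) (D.proj_vars _ _) hent

/-- If the sets of answer constraints are constraint-compact, then the answers of a generator
change finitely often. -/
theorem finite_setOf_getElem?_gens_ne (hE : IsExecution P Q cq E)
    (hstep : ∀ n, Step P (E n) (E (n + 1)))
    (hA : ∀ (g : Literal L ar) (cg : D.Constraint), Constraint.Compact (answerStores E g cg))
    (hlen : {n | (E (n + 1)).gens.length ≠ (E n).gens.length}.Finite) (k : ℕ) :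
    {n | (E (n + 1)).gens[k]? ≠ (E n).gens[k]?}.Finite := by
  by_contra hinf
  -- With changes of length discarded, the `k`-th entry can change only by handling an answer.
  set T := {n | (E (n + 1)).gens[k]? ≠ (E n).gens[k]?} \
    {n | (E (n + 1)).gens.length ≠ (E n).gens.length}
  have hT : T.Infinite := Set.Infinite.sdiff hinf hlen
  have hnew : ∀ n ∈ T, ∃ G, (E n).gens[k]? = some G ∧ ∃ N ∈ (E n).nodes,
      N.root = ⟨{.lit G.lit}, G.store⟩ ∧ N.state.resolvent = 0 ∧
      Covered (E (n + 1)).gens k (D.proj G.lit.vars N.state.store) ∧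
      ¬ Covered (E n).gens k (D.proj G.lit.vars N.state.store) := by
    rintro n ⟨hn, hn'⟩
    rcases (hstep n).gens_cases (hE.wellFormed n) with
      h | ⟨t, -, N, -, -, h, -⟩ | ⟨j, G, hG, N, hN, hroot, hR, h⟩
    · exact (hn (by rw [h])).elim
    · exact (hn' (by simp [h])).elim
    · have hlt := (List.getElem?_eq_some_iff.1 hG).1
      by_cases hjk : j = k
      · subst hjk
        refine ⟨G, hG, N, hN, hroot, hR, ?_, fun ⟨G', hG', hcov⟩ => hn ?_⟩
        · rw [h]
          exact ⟨_, List.getElem?_set_self hlt, exists_mem_addAnswer_entails _ _⟩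
        · obtain rfl := Option.some_injective _ (hG.symm.trans hG')
          rw [h, List.getElem?_set_self hlt, hG, addAnswer_eq_self hcov]
      · exact (hn (by rw [h, List.getElem?_set_ne hjk])).elim
  -- From `n₀` on, the goal of the `k`-th generator is fixed, so all later answers lie in a single
  -- answer set.
  obtain ⟨n₀, hn₀⟩ := hT.nonempty
  obtain ⟨G₀, hG₀, N₀, -⟩ := hnew n₀ hn₀
  have hT' : (T \ Set.Iio n₀).Infinite := hT.sdiff (Set.finite_Iio n₀)
  have hnew' : ∀ n ∈ T \ Set.Iio n₀, ∃ N ∈ (E n).nodes,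
      N.root = ⟨{.lit G₀.lit}, G₀.store⟩ ∧ N.state.resolvent = 0 ∧
      Covered (E (n + 1)).gens k (D.proj G₀.lit.vars N.state.store) ∧
      ¬ Covered (E n).gens k (D.proj G₀.lit.vars N.state.store) := by
    rintro n ⟨hn, hle⟩
    obtain ⟨G, hG, h⟩ := hnew n hn
    obtain ⟨G', hG', hl, hs⟩ := persist_of_le hE hstep (not_lt.1 hle) k G₀ hG₀
    obtain rfl := Option.some_injective _ (hG.symm.trans hG')
    rwa [hl, hs] at h
  have : Nonempty (Node D ar) := ⟨N₀⟩
  choose! N hN hroot hR hcov hncov using hnew'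
  obtain ⟨m, hm, n, hn, hmn, hent⟩ :=
    (hA (G₀.lit.rename (Equiv.refl ℕ)) (Constraint.rename (Equiv.refl ℕ) G₀.store)
      ).exists_entails_of_infinite (G₀.lit.rename (Equiv.refl ℕ)).vars hT'
      (fun n => Constraint.rename (Equiv.refl ℕ) (D.proj G₀.lit.vars (N n).state.store))
      (fun n hn => ⟨N n, ⟨n, hN n hn⟩, G₀.lit, G₀.store, hroot n hn, hR n hn, Equiv.refl ℕ,
        rfl, rfl, rfl⟩)
      (fun n _ => Literal.vars_rename_proj_subset _ _ _)
  -- The answer handled at `m` is still covered at `n`; the one handled at `n` entails it, so it was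
  -- covered already.
  obtain ⟨G, hG, a, ha, hma⟩ := covered_of_le hE hstep (Nat.succ_le_of_lt hmn) (hcov m hm)
  exact hncov n hn ⟨G, hG, a, ha, (Constraint.entails_of_rename hent).trans hma⟩

end Infinite

theorem IsExecution.terminates_of_compact {E : ℕ → Config D ar} (hE : IsExecution P Q cq E)
    (hP : P.RecursionTabled)
    (hC : ∀ g : Literal L ar, Constraint.Compact (callStores E g))
    (hA : ∀ (g : Literal L ar) (cg : D.Constraint), Constraint.Compact (answerStores E g cg)) :
    Terminates P E := by
  by_contra hT
  have hstep : ∀ n, Step P (E n) (E (n + 1)) := fun n =>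
    (hE.next n).resolve_right fun h => hT ⟨n, h.1⟩
  have hlen := finite_setOf_length_gens_ne hE hstep hC
  obtain ⟨n₀, hn₀⟩ := hlen.bddAbove
  have hconst : ∀ n ≥ n₀ + 1, (E n).gens.length = (E (n₀ + 1)).gens.length := by
    intro n hn
    induction n, hn using Nat.le_induction with
    | base => rfl
    | succ n hle ih =>
      rw [← ih]
      by_contra hne
      have := hn₀ hne
      omega
  -- The number of generators is now constant, so finitely many positions `k` have to be bounded
  -- together.
  have hfin := (Set.finite_Iio (E (n₀ + 1)).gens.length).biUnion fun k _ =>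
    finite_setOf_getElem?_gens_ne hE hstep hA hlen k
  obtain ⟨n₁, hn₁⟩ := hfin.bddAbove
  obtain ⟨n, hn, hne⟩ := exists_gens_ne hP hstep (fun n N hN => (hE.wellFormed n N hN).work)
    (max (n₀ + 1) (n₁ + 1))
  refine hne (List.ext_getElem? fun k => ?_)
  by_contra hk
  have hk' : k < (E (n₀ + 1)).gens.length := by
    by_contra hge
    refine hk ?_
    rw [List.getElem?_eq_none, List.getElem?_eq_none]
    · rw [hconst n (by omega)]; omega
    · rw [hconst (n + 1) (by omega)]; omega
  have := hn₁ (Set.mem_biUnion hk' hk)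
  omega

end TCLP

theorem mainTheorem1 {L : FirstOrder.Language} {M : Type*} [L.Structure M] [Nonempty M]
    (D : TCLP.ConstraintDomain L M) {Pred : Type*} {ar : Pred → ℕ}
    (P : TCLP.Program D ar) (hP : P.RecursionTabled)
    (Q : Multiset (TCLP.Literal L ar)) (cq : D.Constraint)
    (E : ℕ → TCLP.Config D ar) (hE : TCLP.IsExecution P Q cq E) :
    TCLP.Terminates P E ↔
      (∀ g : TCLP.Literal L ar, TCLP.Constraint.Compact (TCLP.callStores E g)) ∧
      (∀ (g : TCLP.Literal L ar) (cg : D.Constraint),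
        TCLP.Constraint.Compact (TCLP.answerStores E g cg)) :=
  ⟨fun hT => ⟨TCLP.compact_callStores_of_finite (hE.finite_forest hT),
      TCLP.compact_answerStores_of_finite (hE.finite_forest hT)⟩,
    fun h => hE.terminates_of_compact hP h.1 h.2⟩
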